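/- For integers $m,n\ge 1$ let $\mathcal M_{m\times n}$ be the space of real $m\times n$ matrices with its Euclidean topology, and let $\mathcal M=\bigsqcup_{m,n\ge 1}\mathcal M_{m\times n}$ with the disjoint-union topology. For $A,B\in\mathcal M$ write $A\sim B$ if $A\otimes I_a=B\otimes I_b$ for some integers $a,b\ge 1$, where $\otimes$ is the Kronecker product; this is an equivalence relation, and $\langle A\rangle$ denotes the class of $A$. Let $\mu=\mu_y/\mu_x$ be a positive rational number in lowest terms, let $\mathcal M_\mu=\bigcup_{m/n=\mu}\mathcal M_{m\times n}=\bigcup_{k\ge 1}\mathcal M_\mu^k$ with $\mathcal M_\mu^k=\mathcal M_{k\mu_y\times k\mu_x}$, and let $\Sigma_\mu=\mathcal M_\mu/{\sim}$. Consider the following three topologies on $\Sigma_\mu$. * $\mathcal T_Q$ is the quotient topology of the projection $\mathcal M_\mu\to\Sigma_\mu$, $A\mapsto\langle A\rangle$. * $\mathcal T_P$ is the topology generated, as a subbase, by all sets $\{\langle A\rangle : A\in O\}$ with $k\ge 1$ and $O\subseteq\mathcal M_\mu^k$ open. * $\mathcal T_d$ is the topology of the metric $d(x,y)=\|x-y\|$.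 Here, for $A\in\mathcal M_\mu^\alpha$, $B\in\mathcal M_\mu^\beta$ and $t=\mathrm{lcm}(\alpha,\beta)$, one sets $\langle A\rangle\pm\langle B\rangle=\langle A\otimes I_{t/\alpha}\pm B\otimes I_{t/\beta}\rangle$ and $(\langle A\rangle\mid\langle B\rangle)=\frac1t\,(A\otimes I_{t/\alpha}\mid B\otimes I_{t/\beta})_F$, where $(\cdot\mid\cdot)_F$ is the Frobenius inner product $(X\mid Y)_F=\sum_{i,j}x_{ij}y_{ij}$, and $\|x\|=\sqrt{(x\mid x)}$. (These are independent of the choice of representatives.) Then: 1. $\Sigma_\mu$ is a Hausdorff space under each of $\mathcal T_Q$, $\mathcal T_P$ and $\mathcal T_d$. 2. $\Sigma_\mu$ is both regular and normal under each of $\mathcal T_Q$ and $\mathcal T_d$. Here regular means that a closed set and a point outside it have disjoint open neighbourhoods, and normal means that any two disjoint closed sets have disjoint open neighbourhoods. -/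

import Mathlib

open scoped Kronecker

noncomputable section

namespace STP

/-- The set of all real matrices of all sizes `m × n` with `m, n ≥ 1`. As a topological space it
carries the disjoint-union topology: every `M_{m × n}` is clopen and has its Euclidean topology. -/
abbrev Mat : Type := Σ s : ℕ+ × ℕ+, Matrix (Fin s.1) (Fin s.2) ℝ

namespace Mat

/-- The number of rows. -/
abbrev rows (A : Mat) : ℕ+ := A.1.1

/-- The number of columns. -/
abbrev cols (A : Mat) : ℕ+ := A.1.2

/-- `A ⊗ I_a`, of size `ma × na`. The bijection `Fin m × Fin a ≃ Fin (m * a)` is the usual one,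
`(i, r) ↦ a * i + r`, so this is the usual block form of the Kronecker product. -/
def tensorId (A : Mat) (a : ℕ+) : Mat :=
  ⟨(A.rows * a, A.cols * a),
    Matrix.reindex (finProdFinEquiv (m := A.rows) (n := a)) (finProdFinEquiv (m := A.cols) (n := a))
      (A.2 ⊗ₖ (1 : Matrix (Fin a) (Fin a) ℝ))⟩

/-- The entries of `A`, extended by zero (auxiliary). -/
def entry (A : Mat) (i j : ℕ) : ℝ :=
  if h : i < A.rows ∧ j < A.cols then A.2 ⟨i, h.1⟩ ⟨j, h.2⟩ else 0

theorem ext_entry {A B : Mat} (hs : A.1 = B.1) (he : ∀ i j, A.entry i j = B.entry i j) :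
    A = B := by
  obtain ⟨s, A⟩ := A
  obtain ⟨t, B⟩ := B
  obtain rfl : s = t := hs
  congr 1
  ext i j
  simpa [entry, i.2, j.2] using he i j

theorem entry_tensorId (A : Mat) (a : ℕ+) (i j : ℕ) :
    (A.tensorId a).entry i j =
      if i % (a : ℕ) = j % (a : ℕ) then A.entry (i / a) (j / a) else 0 := by
  have ha : 0 < (a : ℕ) := a.pos
  by_cases h : i < A.rows * (a : ℕ) ∧ j < A.cols * (a : ℕ)
  · have h1 : i / (a : ℕ) < A.rows := (Nat.div_lt_iff_lt_mul ha).2 h.1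
    have h2 : j / (a : ℕ) < A.cols := (Nat.div_lt_iff_lt_mul ha).2 h.2
    have hh : i < (A.tensorId a).rows ∧ j < (A.tensorId a).cols := h
    rw [entry, dif_pos hh, entry, dif_pos ⟨h1, h2⟩]
    change (A.2 ⊗ₖ (1 : Matrix (Fin a) (Fin a) ℝ)) (finProdFinEquiv.symm ⟨i, h.1⟩)
      (finProdFinEquiv.symm ⟨j, h.2⟩) = _
    simp only [finProdFinEquiv_symm_apply, Matrix.kroneckerMap_apply, Matrix.one_apply, mul_ite,
      mul_one, mul_zero, Fin.ext_iff]
    rfl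
  · have h' : ¬ (i / (a : ℕ) < A.rows ∧ j / (a : ℕ) < A.cols) := by
      rwa [Nat.div_lt_iff_lt_mul ha, Nat.div_lt_iff_lt_mul ha]
    have hh : ¬ (i < (A.tensorId a).rows ∧ j < (A.tensorId a).cols) := h
    rw [entry, dif_neg hh, entry, dif_neg h', ite_self]

theorem tensorId_tensorId (A : Mat) (a b : ℕ+) :
    (A.tensorId a).tensorId b = A.tensorId (a * b) := by
  refine ext_entry (Prod.ext (mul_assoc _ _ _) (mul_assoc _ _ _)) fun i j => ?_
  simp only [entry_tensorId, PNat.mul_coe, Nat.div_div_eq_div_mul, mul_comm (a : ℕ) (b : ℕ)]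
  have key : i % ((b : ℕ) * a) = j % ((b : ℕ) * a) ↔
      i % (b : ℕ) = j % (b : ℕ) ∧ (i / (b : ℕ)) % (a : ℕ) = (j / (b : ℕ)) % (a : ℕ) := by
    constructor
    · intro h
      constructor
      · have := congrArg (· % (b : ℕ)) h
        simpa using this
      · have := congrArg (· / (b : ℕ)) h
        simpa [Nat.mod_mul_right_div_self] using this
    · rintro ⟨h1, h2⟩
      rw [Nat.mod_mul, Nat.mod_mul, h1, h2]
  by_cases h1 : i % (b : ℕ) = j % (b : ℕ) <;>
    by_cases h2 : (i / (b : ℕ)) % (a : ℕ) = (j / (b : ℕ)) % (a : ℕ) <;> simp [key, h1, h2]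

/-- `A ∼ B` if `A ⊗ I_a = B ⊗ I_b` for some `a, b ≥ 1`. -/
def Equivalent (A B : Mat) : Prop := ∃ a b : ℕ+, A.tensorId a = B.tensorId b

theorem Equivalent.equivalence : Equivalence Equivalent where
  refl _ := ⟨1, 1, rfl⟩
  symm := fun ⟨a, b, h⟩ => ⟨b, a, h.symm⟩
  trans := by
    rintro A B C ⟨a, b, h⟩ ⟨c, d, h'⟩
    refine ⟨a * c, d * b, ?_⟩
    rw [← tensorId_tensorId, h, tensorId_tensorId, mul_comm b c, ← tensorId_tensorId, h',
      tensorId_tensorId]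

/-- Entrywise sum of two matrices of the same size. -/
def add (A B : Mat) (h : A.1 = B.1) : Mat :=
  ⟨A.1, Matrix.of fun i j => A.2 i j +
    B.2 (Fin.cast (congrArg (fun s : ℕ+ × ℕ+ => (s.1 : ℕ)) h) i)
      (Fin.cast (congrArg (fun s : ℕ+ × ℕ+ => (s.2 : ℕ)) h) j)⟩

/-- `-A`. -/
def neg (A : Mat) : Mat := ⟨A.1, -A.2⟩

/-- The Frobenius inner product `(A | B)_F = ∑ i j, a_ij * b_ij` of two matrices of the same
size. -/
def frobenius (A B : Mat) (h : A.1 = B.1) : ℝ :=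
  ∑ i, ∑ j, A.2 i j *
    B.2 (Fin.cast (congrArg (fun s : ℕ+ × ℕ+ => (s.1 : ℕ)) h) i)
      (Fin.cast (congrArg (fun s : ℕ+ × ℕ+ => (s.2 : ℕ)) h) j)

theorem entry_add (A B : Mat) (h : A.1 = B.1) (i j : ℕ) :
    (A.add B h).entry i j = A.entry i j + B.entry i j := by
  obtain ⟨s, A⟩ := A
  obtain ⟨t, B⟩ := B
  obtain rfl : s = t := h
  simp only [entry, add, rows, cols]
  split_ifs with hij <;> simp [hij]

theorem entry_neg (A : Mat) (i j : ℕ) : A.neg.entry i j = -A.entry i j := by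
  simp only [entry, neg, rows, cols]
  split_ifs with hij <;> simp [hij]

theorem size_tensorId {A B : Mat} (h : A.1 = B.1) (a : ℕ+) :
    (A.tensorId a).1 = (B.tensorId a).1 := by
  simp only [tensorId, rows, cols, h]

theorem add_tensorId (A B : Mat) (h : A.1 = B.1) (a : ℕ+) :
    (A.add B h).tensorId a = (A.tensorId a).add (B.tensorId a) (size_tensorId h a) := by
  refine ext_entry rfl fun i j => ?_
  simp only [entry_tensorId, entry_add]
  split_ifs <;> simp

theorem neg_tensorId (A : Mat) (a : ℕ+) : A.neg.tensorId a = (A.tensorId a).neg := by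
  refine ext_entry rfl fun i j => ?_
  simp only [entry_tensorId, entry_neg]
  split_ifs <;> simp

theorem frobenius_tensorId (A B : Mat) (h : A.1 = B.1) (a : ℕ+) :
    (A.tensorId a).frobenius (B.tensorId a) (size_tensorId h a) = a * A.frobenius B h := by
  obtain ⟨s, A⟩ := A
  obtain ⟨t, B⟩ := B
  obtain rfl : s = t := h
  have e : ∀ C : Matrix (Fin s.1) (Fin s.2) ℝ, (tensorId ⟨s, C⟩ a).2 =
    Matrix.reindex (finProdFinEquiv (m := s.1) (n := a)) (finProdFinEquiv (m := s.2) (n := a))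
      (C ⊗ₖ (1 : Matrix (Fin a) (Fin a) ℝ)) := fun _ => rfl
  simp only [frobenius, Fin.cast_eq_self, e]
  change (∑ i : Fin (s.1 * a), ∑ j : Fin (s.2 * a),
    (A ⊗ₖ (1 : Matrix (Fin a) (Fin a) ℝ)) (finProdFinEquiv.symm i) (finProdFinEquiv.symm j) *
    (B ⊗ₖ (1 : Matrix (Fin a) (Fin a) ℝ)) (finProdFinEquiv.symm i) (finProdFinEquiv.symm j)) = _
  rw [← finProdFinEquiv.sum_comp]
  simp_rw [← (finProdFinEquiv (m := s.2) (n := a)).sum_comp, Equiv.symm_apply_apply,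
    Fintype.sum_prod_type, Matrix.kroneckerMap_apply, Matrix.one_apply]
  simp [Finset.mul_sum]

/-- The number `gcd (m, n)` for `A` of size `m × n`. If `m / n = y / x` in lowest terms, this is the
`k` such that `A` has size `ky × kx`. -/
def level (A : Mat) : ℕ+ := PNat.gcd A.rows A.cols

theorem level_tensorId (A : Mat) (a : ℕ+) : (A.tensorId a).level = A.level * a := by
  apply PNat.eq
  exact Nat.gcd_mul_right _ _ _

end Mat

/-- `M_μ`: all matrices of size `m × n` with `m / n = μ`. -/
abbrev MatOfRatio (μ : ℚ) : Type := {A : Mat // (A.rows : ℚ) / (A.cols : ℚ) = μ}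

/-- `M_μ^k`: the matrices of size `k μ_y × k μ_x`, where `μ = μ_y / μ_x` in lowest terms,
as a subset of `M_μ`. -/
def component (μ : ℚ) (k : ℕ+) : Set (MatOfRatio μ) :=
  {A | (A.1.rows : ℕ) = k * μ.num.natAbs ∧ (A.1.cols : ℕ) = k * μ.den}

namespace MatOfRatio

variable {μ : ℚ}

theorem mem_component_level (A : MatOfRatio μ) : A ∈ component μ A.1.level := by
  obtain ⟨A, hA⟩ := A
  have hc : (A.cols : ℤ) ≠ 0 := by exact_mod_cast A.cols.ne_zero
  have hA' : μ = Rat.divInt (A.rows : ℕ) (A.cols : ℕ) := by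
    rw [← hA, Rat.divInt_eq_div]; push_cast; rfl
  have hg : (A.level : ℕ) = Nat.gcd A.rows A.cols := rfl
  have h1 : μ.num = (A.rows : ℕ) / (Nat.gcd A.rows A.cols : ℤ) := by
    have hs : Int.sign ((A.cols : ℕ) : ℤ) = 1 := Int.sign_eq_one_of_pos (by exact_mod_cast A.cols.pos)
    rw [hA', Rat.num_divInt, hs]
    simp [Int.gcd_comm]
  have h2 : μ.den = A.cols / Nat.gcd A.rows A.cols := by
    rw [hA', Rat.den_divInt]
    simp [Int.gcd_comm]
  constructor
  · change (A.rows : ℕ) = A.level * _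
    rw [h1, hg, ← Int.natCast_div, Int.natAbs_natCast, Nat.mul_div_cancel' (Nat.gcd_dvd_left _ _)]
  · change (A.cols : ℕ) = A.level * _
    rw [h2, hg, Nat.mul_div_cancel' (Nat.gcd_dvd_right _ _)]

theorem mem_component_iff (A : MatOfRatio μ) (k : ℕ+) : A ∈ component μ k ↔ A.1.level = k := by
  constructor
  · intro h
    have h' := A.mem_component_level
    have := h.2.symm.trans h'.2
    exact PNat.eq (Nat.eq_of_mul_eq_mul_right μ.den_pos this).symm
  · rintro rfl
    exact A.mem_component_level

/-- `A ⊗ I_a` as an element of `M_μ`. -/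
def tensorId (A : MatOfRatio μ) (a : ℕ+) : MatOfRatio μ :=
  ⟨A.1.tensorId a, by
    obtain ⟨A, hA⟩ := A
    have ha : (a : ℚ) ≠ 0 := by exact_mod_cast a.ne_zero
    refine Eq.trans ?_ hA
    simp [Mat.tensorId, Mat.rows, Mat.cols, mul_div_mul_right _ _ ha]⟩

theorem size_eq (A B : MatOfRatio μ) (h : A.1.level = B.1.level) : A.1.1 = B.1.1 := by
  have hA := A.mem_component_level
  have hB := B.mem_component_level
  rw [← h] at hB
  exact Prod.ext (PNat.eq (hA.1.trans hB.1.symm)) (PNat.eq (hA.2.trans hB.2.symm))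

theorem size_tensorId_eq (A B : MatOfRatio μ) {x y : ℕ+} (h : A.1.level * x = B.1.level * y) :
    (A.1.tensorId x).1 = (B.1.tensorId y).1 :=
  size_eq (A.tensorId x) (B.tensorId y)
    (by rw [tensorId, tensorId, Mat.level_tensorId, Mat.level_tensorId, h])

/-- For `A ∈ M_μ^α` and `B ∈ M_μ^β`, the number `t = lcm (α, β)`. -/
def commonLevel (A B : MatOfRatio μ) : ℕ+ := PNat.lcm A.1.level B.1.level

/-- The number `t / α`. -/
def leftFactor (A B : MatOfRatio μ) : ℕ+ := PNat.divExact (commonLevel A B) A.1.level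

/-- The number `t / β`. -/
def rightFactor (A B : MatOfRatio μ) : ℕ+ := PNat.divExact (commonLevel A B) B.1.level

theorem level_mul_leftFactor (A B : MatOfRatio μ) :
    A.1.level * leftFactor A B = commonLevel A B :=
  PNat.mul_div_exact (PNat.dvd_lcm_left _ _)

theorem level_mul_rightFactor (A B : MatOfRatio μ) :
    B.1.level * rightFactor A B = commonLevel A B :=
  PNat.mul_div_exact (PNat.dvd_lcm_right _ _)

theorem factor_eq (A B : MatOfRatio μ) :
    A.1.level * leftFactor A B = B.1.level * rightFactor A B :=
  (level_mul_leftFactor A B).trans (level_mul_rightFactor A B).symm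

/-- `(A ⊗ I_{t/α}) + (B ⊗ I_{t/β})` for `A ∈ M_μ^α`, `B ∈ M_μ^β`, `t = lcm (α, β)`. -/
def lplus (A B : MatOfRatio μ) : MatOfRatio μ :=
  ⟨(A.1.tensorId (leftFactor A B)).add (B.1.tensorId (rightFactor A B))
    (size_tensorId_eq A B (factor_eq A B)), (A.tensorId (leftFactor A B)).2⟩

/-- `-A`. -/
def neg (A : MatOfRatio μ) : MatOfRatio μ := ⟨A.1.neg, A.2⟩

/-- The weighted inner product `(1/t) (A ⊗ I_{t/α} | B ⊗ I_{t/β})_F` for `A ∈ M_μ^α`,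
`B ∈ M_μ^β`, `t = lcm (α, β)`. -/
def innerW (A B : MatOfRatio μ) : ℝ :=
  (1 / (commonLevel A B : ℝ)) *
    (A.1.tensorId (leftFactor A B)).frobenius (B.1.tensorId (rightFactor A B))
      (size_tensorId_eq A B (factor_eq A B))

theorem exists_factor (A B : MatOfRatio μ) {x y : ℕ+} (h : A.1.level * x = B.1.level * y) :
    ∃ c, A.1.level * x = commonLevel A B * c ∧ leftFactor A B * c = x ∧
      rightFactor A B * c = y := by
  obtain ⟨c, hc⟩ : commonLevel A B ∣ A.1.level * x :=
    PNat.lcm_dvd (Dvd.intro _ rfl) (h ▸ Dvd.intro _ rfl)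
  refine ⟨c, hc, ?_, ?_⟩
  · apply mul_left_cancel (a := A.1.level)
    rw [← mul_assoc, level_mul_leftFactor, hc]
  · apply mul_left_cancel (a := B.1.level)
    rw [← mul_assoc, level_mul_rightFactor, ← h, hc]

theorem lplus_equivalent (A B : MatOfRatio μ) {x y : ℕ+} (h : A.1.level * x = B.1.level * y) :
    (lplus A B).1.Equivalent
      ((A.1.tensorId x).add (B.1.tensorId y) (size_tensorId_eq A B h)) := by
  obtain ⟨c, -, rfl, rfl⟩ := exists_factor A B h
  refine ⟨c, 1, ?_⟩
  simp only [lplus, Mat.add_tensorId, Mat.tensorId_tensorId, mul_one]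

theorem innerW_eq (A B : MatOfRatio μ) {x y : ℕ+} (h : A.1.level * x = B.1.level * y) :
    innerW A B = (1 / ((A.1.level * x : ℕ+) : ℝ)) *
      (A.1.tensorId x).frobenius (B.1.tensorId y) (size_tensorId_eq A B h) := by
  obtain ⟨c, h1, rfl, rfl⟩ := exists_factor A B h
  have hc : (c : ℝ) ≠ 0 := by exact_mod_cast c.ne_zero
  have ht : (commonLevel A B : ℝ) ≠ 0 := by exact_mod_cast (commonLevel A B).ne_zero
  simp only [h1, ← Mat.tensorId_tensorId, innerW]
  rw [Mat.frobenius_tensorId _ _ (size_tensorId_eq A B (factor_eq A B))]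
  push_cast
  field_simp

theorem equivalent_common {A A' B B' : MatOfRatio μ} (hA : A.1.Equivalent A'.1)
    (hB : B.1.Equivalent B'.1) :
    ∃ x x' y y' : ℕ+, A.1.tensorId x = A'.1.tensorId x' ∧ B.1.tensorId y = B'.1.tensorId y' ∧
      A.1.level * x = B.1.level * y ∧ A'.1.level * x' = B'.1.level * y' ∧
      A.1.level * x = A'.1.level * x' := by
  obtain ⟨a, a', ha⟩ := hA
  obtain ⟨b, b', hb⟩ := hB
  have ha' := congrArg Mat.level ha
  have hb' := congrArg Mat.level hb
  rw [Mat.level_tensorId, Mat.level_tensorId] at ha' hb'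
  refine ⟨a * (B.1.level * b), a' * (B.1.level * b), b * (A.1.level * a), b' * (A.1.level * a),
    ?_, ?_, ?_, ?_, ?_⟩
  · rw [← Mat.tensorId_tensorId, ha, Mat.tensorId_tensorId]
  · rw [← Mat.tensorId_tensorId, hb, Mat.tensorId_tensorId]
  · ac_rfl
  · calc A'.1.level * (a' * (B.1.level * b)) = (A'.1.level * a') * (B.1.level * b) := by ac_rfl
      _ = (A.1.level * a) * (B'.1.level * b') := by rw [ha', hb']
      _ = B'.1.level * (b' * (A.1.level * a)) := by ac_rfl
  · rw [← mul_assoc, ha', mul_assoc]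

theorem lplus_congr {A A' B B' : MatOfRatio μ} (hA : A.1.Equivalent A'.1)
    (hB : B.1.Equivalent B'.1) : (lplus A B).1.Equivalent (lplus A' B').1 := by
  obtain ⟨x, x', y, y', h1, h2, h3, h4, -⟩ := equivalent_common hA hB
  have e := lplus_equivalent A B h3
  have e' := lplus_equivalent A' B' h4
  simp only [h1, h2] at e
  exact Mat.Equivalent.equivalence.trans e (Mat.Equivalent.equivalence.symm e')

theorem innerW_congr {A A' B B' : MatOfRatio μ} (hA : A.1.Equivalent A'.1)
    (hB : B.1.Equivalent B'.1) : innerW A B = innerW A' B' := by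
  obtain ⟨x, x', y, y', h1, h2, h3, h4, h5⟩ := equivalent_common hA hB
  rw [innerW_eq A B h3, innerW_eq A' B' h4]
  simp only [h1, h2, h5]

theorem neg_congr {A A' : MatOfRatio μ} (hA : A.1.Equivalent A'.1) :
    (neg A).1.Equivalent (neg A').1 := by
  obtain ⟨a, b, h⟩ := hA
  exact ⟨a, b, by simp only [neg, Mat.neg_tensorId, h]⟩

end MatOfRatio

/-- The equivalence relation `∼` on `M_μ`. -/
def ratioSetoid (μ : ℚ) : Setoid (MatOfRatio μ) where
  r A B := A.1.Equivalent B.1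
  iseqv := Mat.Equivalent.equivalence.comap Subtype.val

/-- `Σ_μ = M_μ / ∼`. -/
def SigmaSpace (μ : ℚ) : Type := Quotient (ratioSetoid μ)

namespace SigmaSpace

variable {μ : ℚ}

/-- The natural projection `M_μ → Σ_μ`, `A ↦ ⟨A⟩`. -/
def proj (A : MatOfRatio μ) : SigmaSpace μ := Quotient.mk (ratioSetoid μ) A

/-- `⟨A⟩ + ⟨B⟩`. -/
def lplus : SigmaSpace μ → SigmaSpace μ → SigmaSpace μ :=
  Quotient.map₂ MatOfRatio.lplus fun _ _ hA _ _ hB => MatOfRatio.lplus_congr hA hB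

/-- `⟨-A⟩`. -/
def neg : SigmaSpace μ → SigmaSpace μ :=
  Quotient.map MatOfRatio.neg fun _ _ hA => MatOfRatio.neg_congr hA

/-- `⟨A⟩ - ⟨B⟩`. -/
def lminus (x y : SigmaSpace μ) : SigmaSpace μ := lplus x (neg y)

/-- The inner product `(⟨A⟩ | ⟨B⟩) = (A | B)_W` on `Σ_μ`. -/
def innerProd : SigmaSpace μ → SigmaSpace μ → ℝ :=
  Quotient.lift₂ MatOfRatio.innerW fun _ _ _ _ hA hB => MatOfRatio.innerW_congr hA hB

/-- The norm `√(x | x)` on `Σ_μ`. -/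
def nrm (x : SigmaSpace μ) : ℝ := Real.sqrt (innerProd x x)

/-- The distance `d(x, y) = ‖x - y‖` on `Σ_μ`. -/
def dst (x y : SigmaSpace μ) : ℝ := nrm (lminus x y)

end SigmaSpace

/-- The product topology `T_P` on `Σ_μ`: generated, as a subbase, by the sets
`⟨O⟩ = {⟨A⟩ | A ∈ O}` with `O` an open subset of some `M_μ^k`. (The sets `M_μ^k` are open in `M_μ`,
so these are the open sets of `M_μ` that lie in `M_μ^k`.) -/
@[reducible]
def topP (μ : ℚ) : TopologicalSpace (SigmaSpace μ) :=
  TopologicalSpace.generateFrom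
    {S | ∃ (k : ℕ+) (O : Set (MatOfRatio μ)),
      O ⊆ component μ k ∧ IsOpen O ∧ S = SigmaSpace.proj '' O}

/-- The quotient topology `T_Q` on `Σ_μ`. -/
@[reducible]
def topQ (μ : ℚ) : TopologicalSpace (SigmaSpace μ) :=
  TopologicalSpace.coinduced SigmaSpace.proj inferInstance

/-- The metric topology `T_d` on `Σ_μ`: a set is open if it contains a `d`-ball around each of its
points. -/
@[reducible]
def topD (μ : ℚ) : TopologicalSpace (SigmaSpace μ) where
  IsOpen V := ∀ x ∈ V, ∃ ε > 0, ∀ y, SigmaSpace.dst x y < ε → y ∈ V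
  isOpen_univ := fun _ _ => ⟨1, one_pos, fun _ _ => trivial⟩
  isOpen_inter := by
    rintro U V hU hV x ⟨hxU, hxV⟩
    obtain ⟨a, ha, hU⟩ := hU x hxU
    obtain ⟨b, hb, hV⟩ := hV x hxV
    exact ⟨min a b, lt_min ha hb, fun y hy =>
      ⟨hU y (hy.trans_le (min_le_left _ _)), hV y (hy.trans_le (min_le_right _ _))⟩⟩
  isOpen_sUnion := by
    rintro S hS x ⟨V, hV, hx⟩
    obtain ⟨a, ha, h⟩ := hS V hV x hx
    exact ⟨a, ha, fun y hy => ⟨V, hV, h y hy⟩⟩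

end STP

end

open Set Filter Topology

/-! For a fixed size the projection is injective, and `d` pulls back to the Frobenius distance times
a constant. Any three classes have representatives of one size, so `d` is a metric and `T_d` is
Hausdorff and normal. Each space of matrices of one size is finite-dimensional, hence complete, so
it embeds in `(Σ_μ, d)` as a closed subspace (`isClosedEmbedding_proj_ofMatrix`).

`T_Q` is finer than `T_d`, hence Hausdorff. For `T_P`, two classes are separated by open sets of
matrices of a common level, whose images stay disjoint by injectivity.

Normality of `T_Q` is the main point. The levels `n!` give an increasing sequence of `d`-closed
stages covering `Σ_μ`, and a set is `T_Q`-closed exactly when its trace on each stage is `d`-closed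
(`isClosed_topQ_iff`). Thus `T_Q` is a direct limit of closed metric subspaces, and disjoint closed
sets are separated by enlarging neighbourhoods stage by stage (`exists_disjoint_of_isClosed_inter`).
Regularity follows from normality and the Hausdorff property. -/

/-- In a normal space, let `Y` be an increasing sequence of closed sets that covers the space. Two
disjoint sets with closed traces on all `Y n` are contained in disjoint sets with relatively open
traces on all `Y n`. -/
theorem exists_disjoint_of_isClosed_inter {X : Type*} [TopologicalSpace X] [NormalSpace X]
    {Y : ℕ → Set X} (hY : Monotone Y) (hYc : ∀ n, IsClosed (Y n)) (hcov : ∀ x, ∃ n, x ∈ Y n)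
    {C D : Set X} (hC : ∀ n, IsClosed (C ∩ Y n)) (hD : ∀ n, IsClosed (D ∩ Y n))
    (hCD : Disjoint C D) :
    ∃ P Q : Set X, (∀ n, IsClosed (Pᶜ ∩ Y n)) ∧ (∀ n, IsClosed (Qᶜ ∩ Y n)) ∧ C ⊆ P ∧ D ⊆ Q ∧
      Disjoint P Q := by
  have step : ∀ P Q : Set X, IsClosed P → IsClosed Q → Disjoint P Q →
      ∃ U V : Set X, IsOpen U ∧ IsOpen V ∧ P ⊆ U ∧ Q ⊆ V ∧
        Disjoint (closure U) (closure V) := by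
    intro P Q hP hQ hPQ
    obtain ⟨U, hU, hPU, hUQ⟩ := normal_exists_closure_subset hP hQ.isOpen_compl
      (subset_compl_iff_disjoint_right.2 hPQ)
    obtain ⟨V, hV, hQV, hVU⟩ := normal_exists_closure_subset hQ isClosed_closure.isOpen_compl
      (subset_compl_comm.1 hUQ)
    exact ⟨U, V, hU, hV, hPU, hQV, (subset_compl_iff_disjoint_left.1 hVU)⟩
  -- The state at stage `n`: disjoint closed sets in `Y n` that already contain the traces of `C`
  -- and `D`.
  let I := fun n => {p : Set X × Set X // IsClosed p.1 ∧ IsClosed p.2 ∧ Disjoint p.1 p.2 ∧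
    C ∩ Y n ⊆ p.1 ∧ D ∩ Y n ⊆ p.2 ∧ p.1 ⊆ Y n ∧ p.2 ⊆ Y n}
  have base : Nonempty (I 0) := ⟨⟨(C ∩ Y 0, D ∩ Y 0), hC 0, hD 0,
    hCD.mono inter_subset_left inter_subset_left, subset_rfl, subset_rfl, inter_subset_right,
    inter_subset_right⟩⟩
  have next : ∀ n (p : I n), ∃ q : I (n + 1), ∃ U V : Set X, IsOpen U ∧ IsOpen V ∧
      p.1.1 ⊆ U ∧ p.1.2 ⊆ V ∧ U ∩ Y (n + 1) ⊆ q.1.1 ∧ V ∩ Y (n + 1) ⊆ q.1.2 := by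
    rintro n ⟨⟨P, Q⟩, hP, hQ, hPQ, hCP, hDQ, hPY, hQY⟩
    dsimp only at hP hQ hPQ hCP hDQ hPY hQY
    -- The enlarged sets stay disjoint because `P` and `Q` lie in `Y n`: a point of `P` in `D` would
    -- already be in `Q`, and symmetrically.
    obtain ⟨U, V, hU, hV, hPU, hQV, hUV⟩ := step (P ∪ C ∩ Y (n + 1)) (Q ∪ D ∩ Y (n + 1))
      (hP.union (hC _)) (hQ.union (hD _)) (by
        rw [disjoint_left] at hPQ hCD ⊢
        rintro x (hx | hx) (hx' | hx')
        · exact hPQ hx hx'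
        · exact hPQ hx (hDQ ⟨hx'.1, hPY hx⟩)
        · exact hPQ (hCP ⟨hx.1, hQY hx'⟩) hx'
        · exact hCD hx.1 hx'.1)
    rw [union_subset_iff] at hPU hQV
    exact ⟨⟨(closure U ∩ Y (n + 1), closure V ∩ Y (n + 1)), isClosed_closure.inter (hYc _),
      isClosed_closure.inter (hYc _), hUV.mono inter_subset_left inter_subset_left,
      fun x hx => ⟨subset_closure (hPU.2 hx), hx.2⟩, fun x hx => ⟨subset_closure (hQV.2 hx), hx.2⟩,
      inter_subset_right, inter_subset_right⟩, U, V, hU, hV, hPU.1, hQV.1,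
      inter_subset_inter_left _ subset_closure, inter_subset_inter_left _ subset_closure⟩
  choose nxt U V hU hV hPU hQV hUP hVQ using next
  let p : ∀ n, I n := fun n => Nat.rec base.some nxt n
  have hUP' : ∀ n, U n (p n) ∩ Y (n + 1) ⊆ (p (n + 1)).1.1 := fun n => hUP n (p n)
  have hVQ' : ∀ n, V n (p n) ∩ Y (n + 1) ⊆ (p (n + 1)).1.2 := fun n => hVQ n (p n)
  have key : ∀ (P W : ℕ → Set X), (∀ n, IsOpen (W n)) → (∀ n, P n ⊆ W n) → (∀ n, P n ⊆ Y n) →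
      (∀ n, W n ∩ Y (n + 1) ⊆ P (n + 1)) → Monotone P ∧ ∀ n, IsClosed ((⋃ n, P n)ᶜ ∩ Y n) := by
    intro P W hW hPW hPY hWP
    have hmono : Monotone P := monotone_nat_of_le_succ fun n x hx =>
      hWP n ⟨hPW n hx, hY n.le_succ (hPY n hx)⟩
    refine ⟨hmono, fun n => ?_⟩
    -- Inside `Y n` the union of the closed sets `P m` agrees with a union of open sets `W m`. Only
    -- `m ≥ n` is used, so that `Y n ⊆ Y (m + 1)` and points of `W m` in `Y n` enter `P (m + 1)`.
    have : (⋃ n, P n)ᶜ ∩ Y n = (⋃ m, W (n + m))ᶜ ∩ Y n := by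
      ext x
      simp only [mem_inter_iff, mem_compl_iff, mem_iUnion, and_congr_left_iff, not_iff_not]
      refine fun hx => ⟨fun ⟨m, hm⟩ => ⟨m, hPW _ (hmono (Nat.le_add_left _ _) hm)⟩,
        fun ⟨m, hm⟩ => ⟨n + m + 1, hWP _ ⟨hm, hY (by omega) hx⟩⟩⟩
    rw [this]
    exact (isOpen_iUnion fun m => hW _).isClosed_compl.inter (hYc n)
  obtain ⟨hP, hPo⟩ := key (fun n => (p n).1.1) (fun n => U n (p n)) (fun n => hU n _)
    (fun n => hPU n _) (fun n => (p n).2.2.2.2.2.2.1) hUP'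
  obtain ⟨hQ, hQo⟩ := key (fun n => (p n).1.2) (fun n => V n (p n)) (fun n => hV n _)
    (fun n => hQV n _) (fun n => (p n).2.2.2.2.2.2.2) hVQ'
  refine ⟨_, _, hPo, hQo, fun x hx => ?_, fun x hx => ?_, ?_⟩
  · obtain ⟨n, hn⟩ := hcov x
    exact mem_iUnion.2 ⟨n, (p n).2.2.2.2.1 ⟨hx, hn⟩⟩
  · obtain ⟨n, hn⟩ := hcov x
    exact mem_iUnion.2 ⟨n, (p n).2.2.2.2.2.1 ⟨hx, hn⟩⟩
  · rw [disjoint_left]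
    rintro x hx hx'
    obtain ⟨m, hm⟩ := mem_iUnion.1 hx
    obtain ⟨n, hn⟩ := mem_iUnion.1 hx'
    exact disjoint_left.1 (p (max m n)).2.2.2.1 (hP (le_max_left m n) hm)
      (hQ (le_max_right m n) hn)

namespace STP

variable {μ : ℚ}

/-! ### Uniqueness of representatives of a given level -/

namespace Mat

theorem tensorId_one (A : Mat) : A.tensorId 1 = A := by
  refine ext_entry (Prod.ext (mul_one _) (mul_one _)) fun i j => ?_
  simp [entry_tensorId, Nat.mod_one]

theorem tensorId_injective (a : ℕ+) : Function.Injective fun A : Mat => A.tensorId a := by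
  intro A B h
  dsimp only at h
  have hs : A.1 = B.1 := by
    have h1 := congrArg Sigma.fst h
    exact Prod.ext (mul_right_cancel (congrArg Prod.fst h1))
      (mul_right_cancel (congrArg Prod.snd h1))
  refine ext_entry hs fun i j => ?_
  -- The top left entry of each `a × a` block of `A ⊗ I_a` is the corresponding entry of `A`.
  have := congrArg (fun C : Mat => C.entry (a * i) (a * j)) h
  simpa [entry_tensorId, a.pos] using this

/-- Comparing levels in `A ⊗ I_a = B ⊗ I_b` forces `a = b`, and `⊗ I_a` can be cancelled. -/
theorem Equivalent.eq_of_level_eq {A B : Mat} (h : A.Equivalent B) (hl : A.level = B.level) :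
    A = B := by
  obtain ⟨a, b, h⟩ := h
  have h' := congrArg level h
  rw [level_tensorId, level_tensorId, hl] at h'
  obtain rfl := mul_left_cancel h'
  exact tensorId_injective a h

end Mat

/-! ### The topology of `M_μ`, size by size -/

namespace MatOfRatio

theorem level_tensorId (A : MatOfRatio μ) (a : ℕ+) :
    (A.tensorId a).1.level = A.1.level * a :=
  Mat.level_tensorId _ _

theorem isOpen_component (k : ℕ+) : IsOpen (component μ k) := by
  have hf : Continuous fun A : MatOfRatio μ => A.1.1 :=
    (continuous_sigma fun s => by exact continuous_const :
      Continuous fun A : Mat => A.1).comp continuous_subtype_val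
  have : component μ k =
      (fun A : MatOfRatio μ => A.1.1) ⁻¹' {s | PNat.gcd s.1 s.2 = k} := by
    ext A
    exact mem_component_iff A k
  rw [this]
  exact (isOpen_discrete _).preimage hf

/-- The matrix `X` of size `s` as an element of `M_μ`. -/
def ofMatrix (s : ℕ+ × ℕ+) (hs : (s.1 : ℚ) / (s.2 : ℚ) = μ)
    (X : Matrix (Fin s.1) (Fin s.2) ℝ) : MatOfRatio μ := ⟨⟨s, X⟩, hs⟩

theorem continuous_ofMatrix (s : ℕ+ × ℕ+) (hs : (s.1 : ℚ) / (s.2 : ℚ) = μ) :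
    Continuous (ofMatrix s hs) :=
  Continuous.subtype_mk (f := fun X => (⟨s, X⟩ : Mat))
    (continuous_sigmaMk (σ := fun s : ℕ+ × ℕ+ => Matrix (Fin s.1) (Fin s.2) ℝ)) fun _ => hs

theorem exists_ofMatrix {s : ℕ+ × ℕ+} (hs : (s.1 : ℚ) / (s.2 : ℚ) = μ) (A : MatOfRatio μ)
    (h : A.1.level = PNat.gcd s.1 s.2) : ∃ X, ofMatrix s hs X = A := by
  have h' : A.1.1 = s := size_eq A (ofMatrix s hs 0) h
  obtain ⟨⟨t, X⟩, hA⟩ := A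
  subst h'
  exact ⟨X, rfl⟩

theorem isClosed_iff_ofMatrix {G : Set (MatOfRatio μ)} :
    IsClosed G ↔ ∀ s hs, IsClosed (ofMatrix (μ := μ) s hs ⁻¹' G) := by
  refine ⟨fun h s hs => h.preimage (continuous_ofMatrix s hs), fun h => ?_⟩
  rw [← preimage_image_eq G Subtype.val_injective]
  refine IsClosed.preimage continuous_subtype_val (isClosed_sigma_iff.2 fun s => ?_)
  by_cases hs : (s.1 : ℚ) / (s.2 : ℚ) = μ
  · convert h s hs using 1
    ext X
    constructor
    · rintro ⟨A, hA, hAX⟩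
      have : A = ofMatrix s hs X := Subtype.ext hAX
      rwa [this] at hA
    · exact fun hX => ⟨_, hX, rfl⟩
  · convert isClosed_empty
    refine eq_empty_of_forall_notMem ?_
    rintro X ⟨A, -, hAX⟩
    have := A.2
    rw [hAX] at this
    exact hs this

end MatOfRatio

/-! ### The metric on `Σ_μ` -/

namespace SigmaSpace

open MatOfRatio

theorem proj_tensorId (A : MatOfRatio μ) (a : ℕ+) : proj (A.tensorId a) = proj A :=
  Quotient.sound (s := ratioSetoid μ) ⟨1, a, Mat.tensorId_one _⟩

theorem proj_surjective : Function.Surjective (proj (μ := μ)) := Quotient.mk_surjective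

theorem exists_proj_of_level_dvd (A : MatOfRatio μ) {k : ℕ+} (h : A.1.level ∣ k) :
    ∃ B : MatOfRatio μ, B.1.level = k ∧ proj B = proj A := by
  obtain ⟨a, rfl⟩ := h
  exact ⟨A.tensorId a, level_tensorId A a, proj_tensorId A a⟩

theorem proj_injOn_level {A B : MatOfRatio μ} (hl : A.1.level = B.1.level)
    (h : proj A = proj B) : A = B :=
  Subtype.ext (Mat.Equivalent.eq_of_level_eq (Quotient.exact h) hl)

/-- Tensoring up to the product of the three levels reduces the metric axioms to a single normed
space; three points suffice for the triangle inequality. -/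
theorem exists_common_size (x y z : SigmaSpace μ) : ∃ s hs X Y Z,
    proj (ofMatrix s hs X) = x ∧ proj (ofMatrix s hs Y) = y ∧ proj (ofMatrix s hs Z) = z := by
  obtain ⟨A, rfl⟩ := proj_surjective x
  obtain ⟨B, rfl⟩ := proj_surjective y
  obtain ⟨C, rfl⟩ := proj_surjective z
  obtain ⟨A', hA, hA'⟩ := exists_proj_of_level_dvd A
    (k := A.1.level * B.1.level * C.1.level) (Dvd.intro _ (mul_assoc _ _ _).symm)
  obtain ⟨B', hB, hB'⟩ := exists_proj_of_level_dvd B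
    (k := A.1.level * B.1.level * C.1.level) (Dvd.intro (A.1.level * C.1.level) (by ac_rfl))
  obtain ⟨C', hC, hC'⟩ := exists_proj_of_level_dvd C
    (k := A.1.level * B.1.level * C.1.level) (Dvd.intro_left _ rfl)
  obtain ⟨X, hX⟩ := exists_ofMatrix A'.2 A' rfl
  obtain ⟨Y, hY⟩ := exists_ofMatrix A'.2 B' (hB.trans hA.symm)
  obtain ⟨Z, hZ⟩ := exists_ofMatrix A'.2 C' (hC.trans hA.symm)
  exact ⟨A'.1.1, A'.2, X, Y, Z, by rw [hX, hA'], by rw [hY, hB'], by rw [hZ, hC']⟩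

theorem lminus_proj_ofMatrix (s : ℕ+ × ℕ+) (hs : (s.1 : ℚ) / (s.2 : ℚ) = μ)
    (X Y : Matrix (Fin s.1) (Fin s.2) ℝ) :
    lminus (proj (ofMatrix s hs X)) (proj (ofMatrix s hs Y)) = proj (ofMatrix s hs (X - Y)) := by
  refine Quotient.sound (s := ratioSetoid μ) ?_
  have h := lplus_equivalent (ofMatrix s hs X) (MatOfRatio.neg (ofMatrix s hs Y)) (x := 1) (y := 1) rfl
  simp only [Mat.tensorId_one] at h
  have e : (ofMatrix s hs (X - Y)).1 =
      (ofMatrix s hs X).1.add (MatOfRatio.neg (ofMatrix s hs Y)).1 rfl :=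
    congrArg (Sigma.mk s) (Matrix.ext fun _ _ => sub_eq_add_neg _ _)
  rw [← e] at h
  exact h

attribute [local instance] Matrix.frobeniusNormedAddCommGroup Matrix.frobeniusNormedSpace

theorem nrm_proj_ofMatrix (s : ℕ+ × ℕ+) (hs : (s.1 : ℚ) / (s.2 : ℚ) = μ)
    (X : Matrix (Fin s.1) (Fin s.2) ℝ) :
    nrm (proj (ofMatrix s hs X)) = (√(PNat.gcd s.1 s.2 : ℝ))⁻¹ * ‖X‖ := by
  have h := innerW_eq (ofMatrix s hs X) (ofMatrix s hs X) (x := 1) (y := 1) rfl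
  simp only [Mat.tensorId_one, mul_one] at h
  have h' : innerProd (proj (ofMatrix s hs X)) (proj (ofMatrix s hs X)) =
      (PNat.gcd s.1 s.2 : ℝ)⁻¹ * ∑ i, ∑ j, X i j ^ 2 := by
    refine h.trans ?_
    rw [one_div]
    congr 1
    exact Finset.sum_congr rfl fun i _ => Finset.sum_congr rfl fun j _ => (sq _).symm
  rw [nrm, h', Real.sqrt_mul (by positivity), Real.sqrt_inv, Matrix.frobenius_norm_def,
    Real.sqrt_eq_rpow (∑ i, ∑ j, _)]
  simp

theorem dst_proj_ofMatrix (s : ℕ+ × ℕ+) (hs : (s.1 : ℚ) / (s.2 : ℚ) = μ)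
    (X Y : Matrix (Fin s.1) (Fin s.2) ℝ) :
    dst (proj (ofMatrix s hs X)) (proj (ofMatrix s hs Y)) =
      (√(PNat.gcd s.1 s.2 : ℝ))⁻¹ * dist X Y := by
  rw [dst, lminus_proj_ofMatrix, nrm_proj_ofMatrix, dist_eq_norm]

theorem inv_sqrt_pos (k : ℕ+) : 0 < (√(k : ℝ))⁻¹ :=
  inv_pos.2 (Real.sqrt_pos.2 (Nat.cast_pos.2 k.pos))

/-- `Σ_μ` with the distance `d`. -/
@[reducible]
noncomputable def metricSpace (μ : ℚ) : MetricSpace (SigmaSpace μ) where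
  dist := dst
  dist_self x := by
    obtain ⟨s, hs, X, -, -, rfl, -, -⟩ := exists_common_size x x x
    rw [dst_proj_ofMatrix, dist_self, mul_zero]
  dist_comm x y := by
    obtain ⟨s, hs, X, Y, -, rfl, rfl, -⟩ := exists_common_size x y y
    rw [dst_proj_ofMatrix, dst_proj_ofMatrix, dist_comm]
  dist_triangle x y z := by
    obtain ⟨s, hs, X, Y, Z, rfl, rfl, rfl⟩ := exists_common_size x y z
    rw [dst_proj_ofMatrix, dst_proj_ofMatrix, dst_proj_ofMatrix, ← mul_add]
    exact mul_le_mul_of_nonneg_left (dist_triangle _ _ _) (inv_sqrt_pos _).le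
  eq_of_dist_eq_zero {x y} h := by
    obtain ⟨s, hs, X, Y, -, rfl, rfl, -⟩ := exists_common_size x y y
    rw [dst_proj_ofMatrix] at h
    rw [dist_eq_zero.1 ((mul_eq_zero.1 h).resolve_left (inv_sqrt_pos _).ne')]

theorem topD_eq (μ : ℚ) : topD μ = (metricSpace μ).toUniformSpace.toTopologicalSpace := by
  let := metricSpace μ
  refine TopologicalSpace.ext_iff.2 fun V => ?_
  refine Iff.trans ?_ Metric.isOpen_iff.symm
  refine forall₂_congr fun x _ => exists_congr fun ε => and_congr_right fun _ =>
    forall_congr' fun y => ?_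
  rw [Metric.mem_ball, dist_comm]
  rfl

/-- A map scaling distances by a positive constant is Lipschitz and antilipschitz, so completeness
of the source makes its range closed. -/
theorem isClosedEmbedding_proj_ofMatrix (s : ℕ+ × ℕ+) (hs : (s.1 : ℚ) / (s.2 : ℚ) = μ) :
    letI := metricSpace μ
    IsClosedEmbedding fun X => proj (ofMatrix s hs X) := by
  let := metricSpace μ
  have hd : ∀ X Y, dist (proj (ofMatrix s hs X)) (proj (ofMatrix s hs Y)) =
    (√(PNat.gcd s.1 s.2 : ℝ))⁻¹ * dist X Y := dst_proj_ofMatrix s hs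
  have hpos := inv_sqrt_pos (PNat.gcd s.1 s.2)
  have : CompleteSpace (Matrix (Fin s.1) (Fin s.2) ℝ) := FiniteDimensional.complete ℝ _
  refine AntilipschitzWith.isClosedEmbedding
    (K := ⟨√(PNat.gcd s.1 s.2 : ℝ), Real.sqrt_nonneg _⟩)
    (AntilipschitzWith.of_le_mul_dist fun X Y => ?_)
    (LipschitzWith.uniformContinuous (K := ⟨(√(PNat.gcd s.1 s.2 : ℝ))⁻¹, hpos.le⟩)
      (LipschitzWith.of_dist_le_mul fun X Y => (hd X Y).le))
  rw [hd]
  change _ ≤ √(PNat.gcd s.1 s.2 : ℝ) * _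
  rw [← mul_assoc, mul_inv_cancel₀ (inv_pos.1 hpos).ne', one_mul]

theorem topQ_le_topD (μ : ℚ) : topQ μ ≤ topD μ := by
  rw [topD_eq]
  let := metricSpace μ
  refine continuous_iff_coinduced_le.1 (continuous_iff_isClosed.2 fun F hF => ?_)
  exact isClosed_iff_ofMatrix.2 fun s hs =>
    hF.preimage (isClosedEmbedding_proj_ofMatrix s hs).continuous

/-! ### `T_Q` as the direct limit of the factorial stages -/

/-- The set of classes of the matrices in `M_μ^k`, where `k = n!`. -/
def factorialStage (μ : ℚ) (n : ℕ) : Set (SigmaSpace μ) :=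
  proj '' component μ (Nat.toPNat n.factorial n.factorial_pos)

/-- Stages nest along divisibility of levels; factorials form a chain for divisibility in which
every level `k` divides a term, namely `k!`. -/
theorem factorialStage_mono (μ : ℚ) : Monotone (factorialStage μ) := by
  rintro m n hmn _ ⟨A, hA, rfl⟩
  rw [mem_component_iff] at hA
  obtain ⟨B, hB, hAB⟩ := exists_proj_of_level_dvd A (k := (Nat.toPNat n.factorial n.factorial_pos))
    (hA ▸ PNat.dvd_iff.2 (Nat.factorial_dvd_factorial hmn))
  exact ⟨B, (mem_component_iff _ _).2 hB, hAB⟩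

theorem proj_mem_factorialStage (A : MatOfRatio μ) :
    proj A ∈ factorialStage μ A.1.level := by
  obtain ⟨B, hB, hAB⟩ := exists_proj_of_level_dvd A
    (k := (Nat.toPNat (A.1.level : ℕ).factorial (Nat.factorial_pos _)))
    (PNat.dvd_iff.2 (Nat.dvd_factorial A.1.level.pos le_rfl))
  exact ⟨B, (mem_component_iff _ _).2 hB, hAB⟩

theorem isClosed_inter_factorialStage {F : Set (SigmaSpace μ)} (hF : IsClosed[topQ μ] F)
    (n : ℕ) : IsClosed[topD μ] (F ∩ factorialStage μ n) := by
  rw [topD_eq]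
  let := metricSpace μ
  -- A matrix `A` in the stage fixes the one size that all matrices of level `n!` share.
  obtain h | ⟨_, A, hA, -⟩ := (factorialStage μ n).eq_empty_or_nonempty
  · rw [h, inter_empty]
    exact isClosed_empty
  have hA' := (mem_component_iff _ _).1 hA
  have : F ∩ factorialStage μ n =
      (fun X => proj (ofMatrix A.1.1 A.2 X)) '' (ofMatrix A.1.1 A.2 ⁻¹' (proj ⁻¹' F)) := by
    ext x
    constructor
    · rintro ⟨hx, B, hB, rfl⟩
      obtain ⟨X, rfl⟩ := exists_ofMatrix A.2 B (((mem_component_iff _ _).1 hB).trans hA'.symm)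
      exact ⟨X, hx, rfl⟩
    · rintro ⟨X, hX, rfl⟩
      exact ⟨hX, ofMatrix A.1.1 A.2 X, (mem_component_iff _ _).2 hA', rfl⟩
  rw [this]
  exact (isClosedEmbedding_proj_ofMatrix _ _).isClosedMap _
    (((@isClosed_coinduced _ _ _ _ _).1 hF).preimage (continuous_ofMatrix _ _))

theorem isClosed_topQ_iff (F : Set (SigmaSpace μ)) :
    IsClosed[topQ μ] F ↔ ∀ n, IsClosed[topD μ] (F ∩ factorialStage μ n) := by
  refine ⟨isClosed_inter_factorialStage, fun h => ?_⟩
  refine isClosed_coinduced.2 (isClosed_iff_ofMatrix.2 fun s hs => ?_)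
  -- The stage indexed by the level of `s` contains all classes of matrices of size `s`, so this one
  -- trace decides closedness there.
  have h' := h (PNat.gcd s.1 s.2)
  rw [topD_eq] at h'
  let := metricSpace μ
  convert h'.preimage (isClosedEmbedding_proj_ofMatrix s hs).continuous using 1
  ext X
  exact ⟨fun hX => ⟨hX, proj_mem_factorialStage (ofMatrix s hs X)⟩, fun hX => hX.1⟩

/-! ### The separation axioms -/

theorem t2Space_topD (μ : ℚ) : @T2Space (SigmaSpace μ) (topD μ) := by
  rw [topD_eq]
  let := metricSpace μ
  infer_instance

theorem normalSpace_topD (μ : ℚ) : @NormalSpace (SigmaSpace μ) (topD μ) := by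
  rw [topD_eq]
  let := metricSpace μ
  infer_instance

theorem t2Space_topQ (μ : ℚ) : @T2Space (SigmaSpace μ) (topQ μ) :=
  @T2Space.of_injective_continuous _ _ (topQ μ) (topD μ) (t2Space_topD μ) id
    Function.injective_id (continuous_id_iff_le.2 (topQ_le_topD μ))

theorem normalSpace_topQ (μ : ℚ) : @NormalSpace (SigmaSpace μ) (topQ μ) := by
  have hcl : ∀ n, IsClosed[topD μ] (factorialStage μ n) := fun n => by
    simpa using isClosed_inter_factorialStage (@isClosed_univ _ (topQ μ)) n
  have hcov : ∀ x, ∃ n, x ∈ factorialStage μ n := fun x => by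
    obtain ⟨A, rfl⟩ := proj_surjective x
    exact ⟨_, proj_mem_factorialStage A⟩
  refine @NormalSpace.mk _ (topQ μ) fun C D hC hD hCD => ?_
  obtain ⟨P, Q, hP, hQ, hCP, hDQ, hPQ⟩ := @exists_disjoint_of_isClosed_inter _ (topD μ)
    (normalSpace_topD μ) _ (factorialStage_mono μ) hcl hcov _ _
    ((isClosed_topQ_iff C).1 hC) ((isClosed_topQ_iff D).1 hD) hCD
  exact ⟨P, Q, (@isClosed_compl_iff _ (topQ μ) _).1 ((isClosed_topQ_iff _).2 hP),
    (@isClosed_compl_iff _ (topQ μ) _).1 ((isClosed_topQ_iff _).2 hQ), hCP, hDQ, hPQ⟩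

theorem t2Space_topP (μ : ℚ) : @T2Space (SigmaSpace μ) (topP μ) := by
  refine @T2Space.mk _ (topP μ) fun x y hxy => ?_
  obtain ⟨s, hs, X, Y, -, rfl, rfl, -⟩ := exists_common_size x y y
  obtain ⟨U, V, hU, hV, hXU, hYV, hUV⟩ :=
    t2_separation (fun h => hxy (congrArg proj h) : ofMatrix s hs X ≠ ofMatrix s hs Y)
  let k := PNat.gcd s.1 s.2
  refine ⟨proj '' (U ∩ component μ k), proj '' (V ∩ component μ k),
    .basic _ ⟨k, _, inter_subset_right, hU.inter (isOpen_component k), rfl⟩,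
    .basic _ ⟨k, _, inter_subset_right, hV.inter (isOpen_component k), rfl⟩,
    ⟨_, ⟨hXU, (mem_component_iff _ _).2 rfl⟩, rfl⟩, ⟨_, ⟨hYV, (mem_component_iff _ _).2 rfl⟩, rfl⟩,
    ?_⟩
  rw [disjoint_left]
  rintro _ ⟨A, ⟨hA, hAk⟩, rfl⟩ ⟨B, ⟨hB, hBk⟩, hBA⟩
  rw [mem_component_iff] at hAk hBk
  -- Both sets of matrices were cut down to one level so that a common class forces a common matrix.
  obtain rfl := proj_injOn_level (hBk.trans hAk.symm) hBA
  exact disjoint_left.1 hUV hA hB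

end SigmaSpace

end STP

theorem corollary5p4 (μ : ℚ) (hμ : 0 < μ) :
    (@T2Space (STP.SigmaSpace μ) (STP.topQ μ) ∧
      @T2Space (STP.SigmaSpace μ) (STP.topP μ) ∧
      @T2Space (STP.SigmaSpace μ) (STP.topD μ)) ∧
    (@RegularSpace (STP.SigmaSpace μ) (STP.topQ μ) ∧
      @NormalSpace (STP.SigmaSpace μ) (STP.topQ μ)) ∧
    (@RegularSpace (STP.SigmaSpace μ) (STP.topD μ) ∧
      @NormalSpace (STP.SigmaSpace μ) (STP.topD μ)) := by
  have hreg : ∀ T : TopologicalSpace (STP.SigmaSpace μ), T2Space (STP.SigmaSpace μ) →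
      NormalSpace (STP.SigmaSpace μ) → RegularSpace (STP.SigmaSpace μ) := by
    intro T _ _
    infer_instance
  have hQ := STP.SigmaSpace.t2Space_topQ μ
  have hQn := STP.SigmaSpace.normalSpace_topQ μ
  have hD := STP.SigmaSpace.t2Space_topD μ
  have hDn := STP.SigmaSpace.normalSpace_topD μ
  exact ⟨⟨hQ, STP.SigmaSpace.t2Space_topP μ, hD⟩, ⟨hreg _ hQ hQn, hQn⟩, ⟨hreg _ hD hDn, hDn⟩⟩
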